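/- Let $\{\xi_n\}_{n\ge1}$ be i.i.d. real random variables with $\mathbb{E}|\xi_1|<\infty$ and $$\lim_{u\to\infty}u^{-p}\log\mathbb{P}\{|\xi_1|\ge u\}=-c$$ for some constants $p\ge1$ and $0<c<\infty$. Let $q\in(1,\infty]$ be given by $\frac1p+\frac1q=1$ (so $q=\infty$ if $p=1$), and for a sequence $x=\{x_n\}$ put $\|x\|_q=\left(\sum_{n=1}^\infty|x_n|^q\right)^{1/q}$ if $q<\infty$ and $\|x\|_\infty=\sup_n|x_n|$. Let $\{a_n\}$ and $\{b_n\}$ be sequences of positive real numbers with $\sum_{n=1}^\infty a_n^{\min(2,q)}<\infty$ and $\sum_{n=1}^\infty b_n^{\min(2,q)}<\infty$, such that the random series $\sum_{n=1}^\infty a_n|\xi_n|$ and $\sum_{n=1}^\infty b_n|\xi_n|$ converge almost surely. Then $$\lim_{r\to\infty}\frac{\log\mathbb{P}\left\{\sum_{n=1}^\infty a_n|\xi_n|\ge r\right\}}{\log\mathbb{P}\left\{\sum_{n=1}^\infty b_n|\xi_n|\ge r\right\}}=\left(\frac{\|b\|_q}{\|a\|_q}\right)^p$$ and $$\lim_{r\to\infty}\frac{\log\mathbb{P}\left\{\sum_{n=1}^\infty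 a_n|\xi_n|\ge r\|a\|_q\right\}}{\log\mathbb{P}\left\{\sum_{n=1}^\infty b_n|\xi_n|\ge r\|b\|_q\right\}}=1.$$ -/

import Mathlib

open MeasureTheory ProbabilityTheory Filter Topology
open scoped ENNReal

/-- The `ℓ^q` norm of a real sequence, `0 < q ≤ ∞`: `(∑ |a n| ^ q) ^ (1 / q)` for finite `q`, and
`sup |a n|` for `q = ∞`. -/
noncomputable def lqNorm (q : ℝ≥0∞) (a : ℕ → ℝ) : ℝ :=
  if q = ∞ then ⨆ n, |a n| else (∑' n, |a n| ^ q.toReal) ^ (1 / q.toReal)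

/-- The logarithm of the upper tail probability, `log ℙ {∑ a n * |ξ n| ≥ r}`. -/
noncomputable def logUpperTail {Ω : Type*} [MeasurableSpace Ω] (P : Measure Ω)
    (ξ : ℕ → Ω → ℝ) (a : ℕ → ℝ) (r : ℝ) : ℝ :=
  Real.log (P.real {ω | r ≤ ∑' n, a n * |ξ n ω|})

/-! Both limits follow by division from a single asymptotic: `log ℙ {∑ a n * |ξ n| ≥ r}` behaves
like `-c * (r / ‖a‖_q) ^ p`. Almost sure convergence already forces `∑ a n < ∞`, which makes `‖a‖_q`
finite.

Lower bound: if `∑ a n * t n = 1` over a finite set, the event that `|ξ n| ≥ r * t n` on that set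
forces the sum past `r`, and by independence it costs about `exp (-c * r ^ p * ∑ t n ^ p)`. By
Hölder duality the infimum of `∑ t n ^ p` is `‖a‖_q ^ (-p)`.

Upper bound: Hölder would give `(∑ a n * |ξ n|) ^ p ≤ ‖a‖_q ^ p * ∑ |ξ n| ^ p`, but the right-hand
sum need not converge. Enlarging the constant slightly to `B > ‖a‖_q` allows summable weights, hence
`B ^ p * ∑ w n * |ξ n| ^ p`. The Chernoff bound at any `d < c` then costs only a constant factor, as
the product of the moment generating functions converges. Finally `d → c` and `B → ‖a‖_q`. -/

lemma conjugate_exponent_cases {p : ℝ} (hp : 1 ≤ p) {q : ℝ≥0∞}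
    (hq : (ENNReal.ofReal p)⁻¹ + q⁻¹ = 1) :
    (p = 1 ∧ q = ∞) ∨ (q ≠ ∞ ∧ p.HolderConjugate q.toReal) := by
  rcases eq_or_ne q ∞ with rfl | hqt
  · left
    refine ⟨?_, rfl⟩
    simpa using hq
  · right
    refine ⟨hqt, ?_⟩
    have : ENNReal.HolderConjugate (ENNReal.ofReal p) q := ⟨by simpa using hq⟩
    have := ENNReal.HolderConjugate.toReal_of_ne_top (p := ENNReal.ofReal p) (q := q)
      ENNReal.ofReal_ne_top hqt
    rwa [ENNReal.toReal_ofReal (by linarith)] at this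

/-! ### The `ℓ^q` norm and Hölder duality -/

lemma lqNorm_of_ne_top {q : ℝ≥0∞} (hqt : q ≠ ∞) {a : ℕ → ℝ} (ha : ∀ n, 0 < a n) :
    lqNorm q a = (∑' n, a n ^ q.toReal) ^ (1 / q.toReal) := by
  simp [lqNorm, hqt, abs_of_pos (ha _)]

lemma Summable.rpow_of_one_le {a : ℕ → ℝ} (ha : ∀ n, 0 < a n) (hs : Summable a) {s : ℝ}
    (h : 1 ≤ s) : Summable fun n => a n ^ s := by
  refine Summable.of_norm_bounded_eventually_nat hs ?_
  filter_upwards [hs.tendsto_atTop_zero.eventually_le_const zero_lt_one] with n hn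
  rw [Real.norm_of_nonneg (Real.rpow_nonneg (ha n).le _)]
  simpa using Real.rpow_le_rpow_of_exponent_ge (ha n) hn h

lemma Summable.bddAbove_range_abs {a : ℕ → ℝ} (hs : Summable a) :
    BddAbove (Set.range fun n => |a n|) :=
  (hs.abs.tendsto_atTop_zero).bddAbove_range

lemma lqNorm_pos {q : ℝ≥0∞} (hq : 1 ≤ q) {a : ℕ → ℝ} (ha : ∀ n, 0 < a n) (hs : Summable a) :
    0 < lqNorm q a := by
  unfold lqNorm
  split_ifs with h
  · exact (abs_pos.2 (ha 0).ne').trans_le (le_ciSup hs.bddAbove_range_abs 0)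
  · have h1 : 1 ≤ q.toReal := by simpa using ENNReal.toReal_mono h hq
    simp only [abs_of_pos (ha _)]
    exact Real.rpow_pos_of_pos ((hs.rpow_of_one_le ha h1).tsum_pos
      (fun n => (Real.rpow_pos_of_pos (ha n) _).le) 0 (Real.rpow_pos_of_pos (ha 0) _)) _

/-- A finitely supported dual vector that almost attains the `ℓ^q` norm. -/
lemma exists_finite_dual_vector {p : ℝ} (hp : 1 ≤ p) {q : ℝ≥0∞}
    (hq : (ENNReal.ofReal p)⁻¹ + q⁻¹ = 1) {a : ℕ → ℝ} (ha : ∀ n, 0 < a n) (hs : Summable a)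
    (hN : 0 < lqNorm q a) {v : ℝ} (hv : lqNorm q a ^ (-p) < v) :
    ∃ (s : Finset ℕ) (t : ℕ → ℝ), (∀ n ∈ s, 0 < t n) ∧ ∑ n ∈ s, a n * t n = 1 ∧
      ∑ n ∈ s, t n ^ p < v := by
  have hv0 : 0 < v := (Real.rpow_pos_of_pos hN _).trans hv
  rcases conjugate_exponent_cases hp hq with ⟨rfl, rfl⟩ | ⟨hqt, hpq⟩
  · have h1 : v⁻¹ < ⨆ n, |a n| := by
      have : lqNorm ∞ a = ⨆ n, |a n| := by simp [lqNorm]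
      rw [← this]
      rw [Real.rpow_neg_one] at hv
      exact inv_lt_of_inv_lt₀ hN hv
    obtain ⟨n, hn⟩ := exists_lt_of_lt_ciSup h1
    rw [abs_of_pos (ha n)] at hn
    refine ⟨{n}, fun n => (a n)⁻¹, fun m _ => inv_pos.2 (ha m), ?_, ?_⟩
    · simp [(ha n).ne']
    · simpa using inv_lt_of_inv_lt₀ hv0 hn
  · set Q := q.toReal
    have hQ1 : 1 < Q := hpq.symm.lt
    have hsum := hs.rpow_of_one_le ha hQ1.le
    set S := ∑' n, a n ^ Q
    have hS : 0 < S := hsum.tsum_pos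
      (fun n => (Real.rpow_pos_of_pos (ha n) _).le) 0 (Real.rpow_pos_of_pos (ha 0) _)
    have hpow : lqNorm q a ^ (-p) = S ^ (1 - p) := by
      rw [lqNorm_of_ne_top hqt ha, ← Real.rpow_mul hS.le]
      congr 1
      change 1 / Q * -p = _
      have : 1 / Q * -p = -(p / Q) := by ring
      rw [this, hpq.div_conj_eq_sub_one]; ring
    rw [hpow] at hv
    have hT : Tendsto (fun N => (∑ n ∈ Finset.range N, a n ^ Q) ^ (1 - p)) atTop
        (𝓝 (S ^ (1 - p))) :=
      hsum.hasSum.tendsto_sum_nat.rpow_const (Or.inl hS.ne')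
    obtain ⟨N, hNv, hN1⟩ := ((hT.eventually_lt_const hv).and (eventually_ge_atTop 1)).exists
    set T := ∑ n ∈ Finset.range N, a n ^ Q
    have hTpos : 0 < T := Finset.sum_pos (fun n _ => Real.rpow_pos_of_pos (ha n) _)
      ⟨0, Finset.mem_range.2 hN1⟩
    -- The equality case of Hölder for the truncated sequence, for which `∑ t n ^ p = T ^ (1 - p)`.
    refine ⟨Finset.range N, fun n => a n ^ (Q - 1) / T,
      fun n _ => div_pos (Real.rpow_pos_of_pos (ha n) _) hTpos, ?_, ?_⟩
    · have : ∀ n, a n * (a n ^ (Q - 1) / T) = a n ^ Q / T := fun n => by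
        rw [Real.rpow_sub_one (ha n).ne']; field_simp [(ha n).ne']
      simp only [this]
      rw [← Finset.sum_div, div_self hTpos.ne']
    · have : ∀ n, (a n ^ (Q - 1) / T) ^ p = a n ^ Q / T ^ p := fun n => by
        rw [Real.div_rpow (Real.rpow_nonneg (ha n).le _) hTpos.le, ← Real.rpow_mul (ha n).le,
          hpq.symm.sub_one_mul_conj]
      simp only [this]
      rw [← Finset.sum_div]
      change T / T ^ p < v
      rwa [Real.rpow_sub hTpos, Real.rpow_one] at hNv

/-- Weights `w` in `(0, 1]`, summable, for which Hölder's inequality with the measure `w` has a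
constant as close to the `ℓ^q` norm as desired. -/
lemma exists_summable_holder_weights {p : ℝ} (hp : 1 ≤ p) {q : ℝ≥0∞}
    (hq : (ENNReal.ofReal p)⁻¹ + q⁻¹ = 1) {a : ℕ → ℝ} (ha : ∀ n, 0 < a n) (hs : Summable a)
    (hN : 0 < lqNorm q a) {B : ℝ} (hB : lqNorm q a < B) :
    ∃ w : ℕ → ℝ, (∀ n, 0 < w n) ∧ (∀ n, w n ≤ 1) ∧ Summable w ∧
      ∀ (x : ℕ → ℝ) (_ : ∀ n, 0 ≤ x n) (N : ℕ),
        (∑ n ∈ Finset.range N, a n * x n) ^ p ≤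
          B ^ p * ∑ n ∈ Finset.range N, w n * x n ^ p := by
  have hB0 : 0 < B := hN.trans hB
  rcases conjugate_exponent_cases hp hq with ⟨rfl, rfl⟩ | ⟨hqt, hpq⟩
  · refine ⟨fun n => a n / B, fun n => div_pos (ha n) hB0, fun n => ?_, hs.div_const B, ?_⟩
    · rw [div_le_one hB0]
      refine le_trans ?_ hB.le
      simpa [lqNorm] using (le_abs_self _).trans (le_ciSup hs.bddAbove_range_abs n)
    · intro x _ N
      simp only [Real.rpow_one, Finset.mul_sum]
      refine le_of_eq (Finset.sum_congr rfl fun n _ => ?_)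
      field_simp
  · set Q := q.toReal
    have hQ1 : 1 < Q := hpq.symm.lt
    have hQ0 : 0 < Q := hpq.symm.pos
    have hp0 : 0 < p := hpq.pos
    have hsum := hs.rpow_of_one_le ha hQ1.le
    set S := ∑' n, a n ^ Q with hSdef
    set A := ∑' n, a n with hAdef
    have hA : 0 < A := hs.tsum_pos (fun n => (ha n).le) 0 (ha 0)
    have hS : 0 < S := hsum.tsum_pos
      (fun n => (Real.rpow_pos_of_pos (ha n) _).le) 0 (Real.rpow_pos_of_pos (ha 0) _)
    have hSB : S < B ^ Q := by
      have h := Real.rpow_lt_rpow hN.le hB hQ0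
      rw [lqNorm_of_ne_top hqt ha, ← Real.rpow_mul hS.le] at h
      change S ^ (1 / Q * Q) < _ at h
      rwa [one_div_mul_cancel hQ0.ne', Real.rpow_one] at h
    -- The slack between `S` and `B ^ Q` is spread proportionally to `a n`, so that `S + h * A = B ^
    -- Q`; `K` is then chosen so that the weight `K * a n` adds exactly `h * a n`.
    set h := (B ^ Q - S) / A with hh
    have hh0 : 0 < h := div_pos (sub_pos.2 hSB) hA
    set K := h ^ (-(p - 1)) with hK
    have hK0 : 0 < K := Real.rpow_pos_of_pos hh0 _
    have hKh : K ^ (-(Q - 1)) = h := by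
      rw [hK, ← Real.rpow_mul hh0.le]
      have : -(p - 1) * -(Q - 1) = 1 := by
        have := hpq.mul_eq_add
        nlinarith
      rw [this, Real.rpow_one]
    have hw0 : ∀ n, 0 < min 1 (K * a n) := fun n => lt_min one_pos (mul_pos hK0 (ha n))
    refine ⟨fun n => min 1 (K * a n), hw0, fun n => min_le_left _ _,
      Summable.of_nonneg_of_le (fun n => (hw0 n).le) (fun n => min_le_right _ _)
        (hs.mul_left K), ?_⟩
    intro x hx N
    set w : ℕ → ℝ := fun n => min 1 (K * a n) with hw
    have key : ∀ n, (a n * w n ^ (-(1 / p))) ^ Q ≤ a n ^ Q + h * a n := by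
      intro n
      have e : (a n * w n ^ (-(1 / p))) ^ Q = a n ^ Q * w n ^ (-(Q - 1)) := by
        rw [Real.mul_rpow (ha n).le (Real.rpow_nonneg (hw0 n).le _), ← Real.rpow_mul (hw0 n).le,
          ← hpq.symm.div_conj_eq_sub_one]
        congr 2
        ring
      rw [e]
      rcases le_total 1 (K * a n) with h1 | h1
      · have : w n = 1 := min_eq_left h1
        rw [this, Real.one_rpow, mul_one]
        have := mul_pos hh0 (ha n)
        linarith
      · have : w n = K * a n := min_eq_right h1
        rw [this, Real.mul_rpow hK0.le (ha n).le, hKh, mul_left_comm, ← Real.rpow_add (ha n)]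
        have h2 : Q + -(Q - 1) = 1 := by ring
        rw [h2, Real.rpow_one]
        have := Real.rpow_pos_of_pos (ha n) Q
        linarith
    have hsumle : ∑ n ∈ Finset.range N, (a n * w n ^ (-(1 / p))) ^ Q ≤ B ^ Q := by
      calc _ ≤ ∑ n ∈ Finset.range N, (a n ^ Q + h * a n) := Finset.sum_le_sum fun n _ => key n
        _ ≤ ∑' n, (a n ^ Q + h * a n) := (hsum.add (hs.mul_left h)).sum_le_tsum _ fun n _ =>
            add_nonneg (Real.rpow_nonneg (ha n).le _) (mul_pos hh0 (ha n)).le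
        _ = S + h * A := by rw [hsum.tsum_add (hs.mul_left h), tsum_mul_left]
        _ = B ^ Q := by rw [hh]; field_simp; ring
    have hsum0 : 0 ≤ ∑ n ∈ Finset.range N, (a n * w n ^ (-(1 / p))) ^ Q :=
      Finset.sum_nonneg fun n _ => Real.rpow_nonneg
        (mul_nonneg (ha n).le (Real.rpow_nonneg (hw0 n).le _)) _
    have hW0 : 0 ≤ ∑ n ∈ Finset.range N, w n * x n ^ p :=
      Finset.sum_nonneg fun n _ => mul_nonneg (hw0 n).le (Real.rpow_nonneg (hx n) _)
    have hold := Real.inner_le_Lp_mul_Lq_of_nonneg (Finset.range N) hpq.symm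
      (f := fun n => a n * w n ^ (-(1 / p))) (g := fun n => w n ^ (1 / p) * x n)
      (fun n _ => mul_nonneg (ha n).le (Real.rpow_nonneg (hw0 n).le _))
      (fun n _ => mul_nonneg (Real.rpow_nonneg (hw0 n).le _) (hx n))
    have e1 : ∀ n, a n * w n ^ (-(1 / p)) * (w n ^ (1 / p) * x n) = a n * x n := fun n => by
      have : w n ^ (-(1 / p)) * w n ^ (1 / p) = 1 := by
        rw [← Real.rpow_add (hw0 n)]; simp
      calc _ = a n * (w n ^ (-(1 / p)) * w n ^ (1 / p)) * x n := by ring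
        _ = _ := by rw [this, mul_one]
    have e2 : ∀ n, (w n ^ (1 / p) * x n) ^ p = w n * x n ^ p := fun n => by
      rw [Real.mul_rpow (Real.rpow_nonneg (hw0 n).le _) (hx n), ← Real.rpow_mul (hw0 n).le,
        one_div_mul_cancel hp0.ne', Real.rpow_one]
    simp only [e1, e2] at hold
    have h3 : (∑ n ∈ Finset.range N, (a n * w n ^ (-(1 / p))) ^ Q) ^ (1 / Q) ≤ B := by
      calc _ ≤ (B ^ Q) ^ (1 / Q) := Real.rpow_le_rpow hsum0 hsumle (by positivity)
        _ = B := by rw [← Real.rpow_mul hB0.le, mul_one_div_cancel hQ0.ne', Real.rpow_one]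
    calc (∑ n ∈ Finset.range N, a n * x n) ^ p
        ≤ (B * (∑ n ∈ Finset.range N, w n * x n ^ p) ^ (1 / p)) ^ p :=
          Real.rpow_le_rpow (Finset.sum_nonneg fun n _ => mul_nonneg (ha n).le (hx n))
            (hold.trans (mul_le_mul_of_nonneg_right h3 (Real.rpow_nonneg hW0 _))) hp0.le
      _ = B ^ p * ∑ n ∈ Finset.range N, w n * x n ^ p := by
          rw [Real.mul_rpow hB0.le (Real.rpow_nonneg hW0 _), ← Real.rpow_mul hW0,
            one_div_mul_cancel hp0.ne', Real.rpow_one]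

/-! ### Exponential tails and moments -/

lemma eventually_exp_le_of_tendsto_log {f : ℝ → ℝ} (hf : ∀ u, 0 ≤ f u) {p c d : ℝ} (hc : 0 < c)
    (h : Tendsto (fun u : ℝ => u ^ (-p) * Real.log (f u)) atTop (𝓝 (-c))) (hd : c < d) :
    ∀ᶠ u in atTop, Real.exp (-d * u ^ p) ≤ f u := by
  filter_upwards [h.eventually_const_lt (neg_lt_neg hd),
    h.eventually_lt_const (neg_lt_zero.2 hc), eventually_gt_atTop 0] with u h1 h2 hu
  have hup := Real.rpow_pos_of_pos hu p
  rw [Real.rpow_neg hu.le, inv_mul_eq_div, lt_div_iff₀ hup] at h1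
  -- Since `Real.log 0 = 0`, a vanishing tail would contradict the negative limit.
  have hne : f u ≠ 0 := fun h0 => by simp [h0] at h2
  rw [← Real.le_log_iff_exp_le ((hf u).lt_of_ne' hne)]
  exact h1.le

lemma eventually_le_exp_of_tendsto_log {f : ℝ → ℝ} {p c d : ℝ}
    (h : Tendsto (fun u : ℝ => u ^ (-p) * Real.log (f u)) atTop (𝓝 (-c))) (hd : d < c) :
    ∀ᶠ u in atTop, f u ≤ Real.exp (-d * u ^ p) := by
  filter_upwards [h.eventually_lt_const (neg_lt_neg hd), eventually_gt_atTop 0] with u h1 hu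
  have hup := Real.rpow_pos_of_pos hu p
  rw [Real.rpow_neg hu.le, inv_mul_eq_div, div_lt_iff₀ hup] at h1
  exact (Real.le_exp_log _).trans (Real.exp_le_exp.2 h1.le)

/-- Slicing by the integer part of `Y` bounds the integral by a series whose terms are eventually
dominated by a geometric one of ratio `exp (-(e - d))`. -/
lemma integrable_exp_mul_of_tail_le {Ω : Type*} [MeasurableSpace Ω] {P : Measure Ω}
    [IsFiniteMeasure P] {Y : Ω → ℝ} (hY : Measurable Y) (hY0 : ∀ ω, 0 ≤ Y ω) {d e : ℝ}
    (hd : 0 ≤ d) (hde : d < e)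
    (h : ∀ᶠ t in atTop, P.real {ω | t ≤ Y ω} ≤ Real.exp (-e * t)) :
    Integrable (fun ω => Real.exp (d * Y ω)) P := by
  refine ⟨by fun_prop, ?_⟩
  rw [hasFiniteIntegral_iff_ofReal (ae_of_all _ fun ω => (Real.exp_pos _).le)]
  let s : ℕ → Set Ω := fun k => {ω | (k : ℝ) ≤ Y ω}
  have hs : ∀ k, MeasurableSet (s k) := fun k => measurableSet_le measurable_const hY
  let f : ℕ → Ω → ℝ≥0∞ := fun k =>
    (s k).indicator fun _ => ENNReal.ofReal (Real.exp (d * (k + 1)))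
  have hle : ∀ ω, ENNReal.ofReal (Real.exp (d * Y ω)) ≤ ∑' k, f k ω := by
    intro ω
    refine le_trans ?_ (ENNReal.le_tsum ⌊Y ω⌋₊)
    have hmem : ω ∈ s ⌊Y ω⌋₊ := Nat.floor_le (hY0 ω)
    simp only [f, Set.indicator_of_mem hmem]
    refine ENNReal.ofReal_le_ofReal (Real.exp_le_exp.2 (mul_le_mul_of_nonneg_left ?_ hd))
    exact (Nat.lt_floor_add_one _).le
  have hsummable : Summable fun k : ℕ => Real.exp (d * (k + 1)) * P.real (s k) := by
    have hg : Summable fun k : ℕ => Real.exp d * Real.exp (-(e - d)) ^ k :=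
      (summable_geometric_of_lt_one (Real.exp_pos _).le
        (Real.exp_zero ▸ Real.exp_lt_exp.2 (by linarith))).mul_left _
    refine Summable.of_norm_bounded_eventually_nat hg ?_
    filter_upwards [tendsto_natCast_atTop_atTop.eventually h] with k hk
    rw [Real.norm_of_nonneg (by positivity)]
    calc _ ≤ Real.exp (d * (k + 1)) * Real.exp (-e * k) :=
          mul_le_mul_of_nonneg_left hk (Real.exp_pos _).le
      _ = _ := by
          rw [← Real.exp_nat_mul, ← Real.exp_add, ← Real.exp_add]
          ring_nf
  calc ∫⁻ ω, ENNReal.ofReal (Real.exp (d * Y ω)) ∂P ≤ ∫⁻ ω, ∑' k, f k ω ∂P := lintegral_mono hle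
    _ = ∑' k, ∫⁻ ω, f k ω ∂P :=
        lintegral_tsum fun k => (measurable_const.indicator (hs k)).aemeasurable
    _ = ∑' k : ℕ, ENNReal.ofReal (Real.exp (d * (k + 1)) * P.real (s k)) := by
        congr 1; ext k
        rw [lintegral_indicator_const (hs k), ENNReal.ofReal_mul (Real.exp_pos _).le,
          ofReal_measureReal]
    _ < ∞ := hsummable.tsum_ofReal_lt_top

/-- Convexity of `exp` between `0` and `d * Y`, then `1 + x ≤ exp x`. The exponent is linear in `w`,
so products over summable weights stay bounded. -/
lemma mgf_mul_le {Ω : Type*} [MeasurableSpace Ω] {P : Measure Ω} [IsProbabilityMeasure P]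
    {Y : Ω → ℝ} (hY : Measurable Y) {d w : ℝ} (hw0 : 0 ≤ w) (hw1 : w ≤ 1)
    (hint : Integrable (fun ω => Real.exp (d * Y ω)) P) :
    Integrable (fun ω => Real.exp (d * (w * Y ω))) P ∧
      mgf (fun ω => w * Y ω) P d ≤ Real.exp ((mgf Y P d - 1) * w) := by
  have hle : ∀ ω, Real.exp (d * (w * Y ω)) ≤ (1 - w) + w * Real.exp (d * Y ω) := by
    intro ω
    have := convexOn_exp.2 (Set.mem_univ 0) (Set.mem_univ (d * Y ω)) (sub_nonneg.2 hw1) hw0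
      (by ring)
    simp only [smul_eq_mul, mul_zero, zero_add, Real.exp_zero, mul_one] at this
    rwa [mul_left_comm]
  have hint' : Integrable (fun ω => (1 - w) + w * Real.exp (d * Y ω)) P :=
    (integrable_const _).add (hint.const_mul w)
  have hi : Integrable (fun ω => Real.exp (d * (w * Y ω))) P :=
    hint'.mono' (by fun_prop) (ae_of_all _ fun ω => by
      rw [Real.norm_of_nonneg (Real.exp_pos _).le]; exact hle ω)
  refine ⟨hi, ?_⟩
  calc mgf (fun ω => w * Y ω) P d ≤ ∫ ω, ((1 - w) + w * Real.exp (d * Y ω)) ∂P :=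
        integral_mono hi hint' hle
    _ = (mgf Y P d - 1) * w + 1 := by
        rw [integral_add (integrable_const _) (hint.const_mul w), integral_const,
          integral_const_mul]
        simp [mgf]; ring
    _ ≤ _ := Real.add_one_le_exp _

/-- Chernoff bound for weighted sums of i.i.d. variables, uniform in the number of terms. -/
lemma measureReal_weighted_sum_ge_le {Ω : Type*} [MeasurableSpace Ω] {P : Measure Ω}
    [IsProbabilityMeasure P] {Y : ℕ → Ω → ℝ} (hY : ∀ n, Measurable (Y n)) (hY0 : ∀ n ω, 0 ≤ Y n ω)
    (hindep : iIndepFun Y P) (hident : ∀ n, IdentDistrib (Y n) (Y 0) P P) {d : ℝ} (hd : 0 ≤ d)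
    (hint : Integrable (fun ω => Real.exp (d * Y 0 ω)) P)
    {w : ℕ → ℝ} (hw0 : ∀ n, 0 < w n) (hw1 : ∀ n, w n ≤ 1) (hw : Summable w) (N : ℕ) (y : ℝ) :
    P.real {ω | y ≤ ∑ n ∈ Finset.range N, w n * Y n ω} ≤
      Real.exp ((mgf (Y 0) P d - 1) * ∑' n, w n) * Real.exp (-d * y) := by
  have hintn : ∀ n, Integrable (fun ω => Real.exp (d * Y n ω)) P := fun n =>
    ((hident n).comp (u := fun x => Real.exp (d * x)) (by fun_prop)).integrable_iff.2 hint
  have hmgf : ∀ n, mgf (Y n) P d = mgf (Y 0) P d := fun n =>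
    congrFun (mgf_congr_identDistrib (hident n)) d
  have hind : iIndepFun (fun n ω => w n * Y n ω) P :=
    hindep.comp (fun n x => w n * x) (fun n => by fun_prop)
  have hmeas : ∀ n, Measurable (fun ω => w n * Y n ω) := fun n => (hY n).const_mul _
  have hi := hind.integrable_exp_mul_sum (t := d) hmeas (s := Finset.range N)
    fun n _ => (mgf_mul_le (hY n) (hw0 n).le (hw1 n) (hintn n)).1
  have hch := measure_ge_le_exp_mul_mgf y hd hi
  simp only [Finset.sum_apply] at hch
  have hm1 : 0 ≤ mgf (Y 0) P d - 1 := by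
    have : ∫ _ω, (1 : ℝ) ∂P ≤ mgf (Y 0) P d := integral_mono (integrable_const _) hint fun ω =>
      Real.one_le_exp (mul_nonneg hd (hY0 0 ω))
    simpa using this
  refine hch.trans ?_
  rw [mul_comm]
  refine mul_le_mul_of_nonneg_right ?_ (Real.exp_pos _).le
  rw [hind.mgf_sum hmeas]
  calc ∏ n ∈ Finset.range N, mgf (fun ω => w n * Y n ω) P d
      ≤ ∏ n ∈ Finset.range N, Real.exp ((mgf (Y 0) P d - 1) * w n) :=
        Finset.prod_le_prod (fun n _ => mgf_nonneg) fun n _ => by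
          have := (mgf_mul_le (hY n) (hw0 n).le (hw1 n) (hintn n)).2
          rwa [hmgf n] at this
    _ = Real.exp ((mgf (Y 0) P d - 1) * ∑ n ∈ Finset.range N, w n) := by
        rw [← Real.exp_sum, Finset.mul_sum]
    _ ≤ _ := Real.exp_le_exp.2 (mul_le_mul_of_nonneg_left
        (hw.sum_le_tsum _ fun n _ => (hw0 n).le) hm1)

/-- Almost sure convergence of `∑ a n * |ξ n|` forces `∑ a n < ∞` as soon as the `|ξ n|` are
uniformly bounded away from `0` with positive probability. -/
lemma summable_of_ae_summable_mul {Ω : Type*} [MeasurableSpace Ω] {P : Measure Ω}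
    [IsProbabilityMeasure P] {ξ : ℕ → Ω → ℝ} (hmeas : ∀ n, Measurable (ξ n)) {a : ℕ → ℝ}
    (ha : ∀ n, 0 < a n) (h : ∀ᵐ ω ∂P, Summable fun n => a n * |ξ n ω|) {u ε : ℝ} (hu : 0 < u)
    (hε : 0 < ε) (hlow : ∀ n, 2 * ε ≤ P.real {ω | u ≤ |ξ n ω|}) : Summable a := by
  -- Some `G M` has probability above `1 - ε`, hence meets each event `u ≤ |ξ n|` with probability
  -- at least `ε`. Integrating the partial sums over `G M` then bounds `∑ a n` by `M / (u * ε)`.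
  let G : ℕ → Set Ω := fun M => {ω | ∀ N, ∑ n ∈ Finset.range N, a n * |ξ n ω| ≤ M}
  have hGm : ∀ M, MeasurableSet (G M) := fun M => by
    have : G M = ⋂ N, {ω | ∑ n ∈ Finset.range N, a n * |ξ n ω| ≤ M} := by ext; simp [G]
    rw [this]
    exact MeasurableSet.iInter fun N => measurableSet_le
      (Finset.measurable_sum _ fun n _ => (hmeas n).abs.const_mul _) measurable_const
  have hmono : Monotone G := fun M M' hM ω hω N =>
    (hω N).trans (Nat.cast_le.2 hM)
  have hunion : P (⋃ M, G M) = 1 := by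
    rw [← measure_univ (μ := P)]
    refine measure_congr ?_
    filter_upwards [h] with ω hω
    refine eq_true (Set.mem_iUnion.2 ?_) |>.trans (eq_true (Set.mem_univ ω)).symm
    obtain ⟨M, hM⟩ := exists_nat_ge (∑' n, a n * |ξ n ω|)
    exact ⟨M, fun N => (hω.sum_le_tsum _ fun n _ =>
      mul_nonneg (ha n).le (abs_nonneg _)).trans hM⟩
  have hT : Tendsto (fun M => P.real (G M)) atTop (𝓝 1) := by
    have := tendsto_measure_iUnion_atTop (μ := P) hmono
    rw [hunion] at this
    exact (ENNReal.tendsto_toReal ENNReal.one_ne_top).comp this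
  obtain ⟨M, hM⟩ := (hT.eventually_const_lt (show 1 - ε < 1 by linarith)).exists
  have hB : ∀ n, MeasurableSet {ω | u ≤ |ξ n ω|} := fun n =>
    measurableSet_le measurable_const (hmeas n).abs
  have hinter : ∀ n, ε ≤ P.real (G M ∩ {ω | u ≤ |ξ n ω|}) := fun n => by
    have h1 := measureReal_union_add_inter (μ := P) (s := G M) (hB n)
    have h2 : P.real (G M ∪ {ω | u ≤ |ξ n ω|}) ≤ 1 := measureReal_le_one
    have h3 := hlow n
    linarith
  refine summable_of_sum_range_le (c := M / (u * ε)) (fun n => (ha n).le) fun N => ?_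
  rw [le_div_iff₀ (mul_pos hu hε)]
  let g : Ω → ℝ := fun ω => ∑ n ∈ Finset.range N,
    (G M ∩ {ω | u ≤ |ξ n ω|}).indicator (fun _ => a n * u) ω
  have hgle : ∀ ω, g ω ≤ M := by
    intro ω
    by_cases hω : ω ∈ G M
    · refine le_trans (Finset.sum_le_sum fun n _ => ?_) (hω N)
      refine Set.indicator_apply_le' (fun hx => ?_) (fun _ => ?_)
      · exact mul_le_mul_of_nonneg_left hx.2 (ha n).le
      · exact mul_nonneg (ha n).le (abs_nonneg _)
    · have : g ω = 0 := Finset.sum_eq_zero fun n _ =>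
        Set.indicator_of_notMem (fun hx => hω hx.1) _
      rw [this]; positivity
  have hterm : ∀ n, Integrable
      ((G M ∩ {ω | u ≤ |ξ n ω|}).indicator (fun _ => a n * u)) P := fun n =>
    (integrable_const _).indicator ((hGm M).inter (hB n))
  calc (∑ n ∈ Finset.range N, a n) * (u * ε) = ∑ n ∈ Finset.range N, ε * (a n * u) := by
        rw [Finset.sum_mul]; exact Finset.sum_congr rfl fun n _ => by ring
    _ ≤ ∑ n ∈ Finset.range N, P.real (G M ∩ {ω | u ≤ |ξ n ω|}) * (a n * u) :=
        Finset.sum_le_sum fun n _ =>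
          mul_le_mul_of_nonneg_right (hinter n) (mul_pos (ha n) hu).le
    _ = ∫ ω, g ω ∂P := by
        rw [integral_finsetSum _ fun n _ => hterm n]
        refine Finset.sum_congr rfl fun n _ => ?_
        rw [integral_indicator_const _ ((hGm M).inter (hB n)), smul_eq_mul]
    _ ≤ ∫ _ω, (M : ℝ) ∂P := integral_mono (integrable_finsetSum _ fun n _ => hterm n)
        (integrable_const _) hgle
    _ = M := by simp

/-! ### Upper and lower tail bounds -/

lemma measureReal_tsum_ge_le {Ω : Type*} [MeasurableSpace Ω] {P : Measure Ω}
    [IsProbabilityMeasure P] {ξ : ℕ → Ω → ℝ} (hmeas : ∀ n, Measurable (ξ n))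
    (hindep : iIndepFun ξ P) (hident : ∀ n, IdentDistrib (ξ n) (ξ 0) P P)
    {p c : ℝ} (hp : 1 ≤ p)
    (htail : Tendsto (fun u : ℝ => u ^ (-p) * Real.log (P.real {ω | u ≤ |ξ 0 ω|}))
      atTop (𝓝 (-c)))
    {q : ℝ≥0∞} (hq : (ENNReal.ofReal p)⁻¹ + q⁻¹ = 1) {a : ℕ → ℝ} (ha : ∀ n, 0 < a n)
    (hs : Summable a) (hN : 0 < lqNorm q a)
    (hconv : ∀ᵐ ω ∂P, Summable fun n => a n * |ξ n ω|)
    {B d : ℝ} (hB : lqNorm q a < B) (hd : 0 < d) (hdc : d < c) :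
    ∃ K, 0 < K ∧ ∀ r, 0 < r →
      P.real {ω | r ≤ ∑' n, a n * |ξ n ω|} ≤ K * Real.exp (-d * (r / B) ^ p) := by
  have hB0 : 0 < B := hN.trans hB
  have hp0 : 0 < p := by linarith
  obtain ⟨w, hw0, hw1, hw, hold⟩ := exists_summable_holder_weights hp hq ha hs hN hB
  let Y : ℕ → Ω → ℝ := fun n ω => |ξ n ω| ^ p
  have hφ : Measurable fun x : ℝ => |x| ^ p := by fun_prop
  have hY : ∀ n, Measurable (Y n) := fun n => hφ.comp (hmeas n)
  have hY0 : ∀ n ω, 0 ≤ Y n ω := fun n ω => Real.rpow_nonneg (abs_nonneg _) _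
  have hint : Integrable (fun ω => Real.exp (d * Y 0 ω)) P := by
    obtain ⟨e, hde, hec⟩ := exists_between hdc
    refine integrable_exp_mul_of_tail_le (hY 0) (hY0 0) hd.le hde ?_
    have hroot : Tendsto (fun t : ℝ => t ^ (1 / p)) atTop atTop :=
      tendsto_rpow_atTop (by positivity)
    filter_upwards [hroot.eventually (eventually_le_exp_of_tendsto_log htail hec),
      eventually_ge_atTop 0] with t ht ht0
    rw [← Real.rpow_mul ht0, one_div_mul_cancel hp0.ne', Real.rpow_one] at ht
    refine le_trans (measureReal_mono fun ω hω => ?_) ht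
    have := Real.rpow_le_rpow ht0 (show t ≤ |ξ 0 ω| ^ p from hω) (one_div_pos.2 hp0).le
    rwa [← Real.rpow_mul (abs_nonneg _), mul_one_div_cancel hp0.ne', Real.rpow_one] at this
  refine ⟨Real.exp ((mgf (Y 0) P d - 1) * ∑' n, w n), Real.exp_pos _, fun r hr => ?_⟩
  set K := Real.exp ((mgf (Y 0) P d - 1) * ∑' n, w n)
  have hfin : ∀ N ρ, 0 < ρ → P.real {ω | ρ < ∑ n ∈ Finset.range N, a n * |ξ n ω|} ≤
      K * Real.exp (-d * (ρ / B) ^ p) := by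
    intro N ρ hρ
    refine le_trans (measureReal_mono fun ω hω => ?_)
      (measureReal_weighted_sum_ge_le hY hY0 (hindep.comp (fun _ x => |x| ^ p) fun _ => hφ)
        (fun n => (hident n).comp hφ) hd.le hint hw0 hw1 hw N ((ρ / B) ^ p))
    have h1 := hold (fun n => |ξ n ω|) (fun n => abs_nonneg _) N
    have h2 := Real.rpow_le_rpow hρ.le (show ρ ≤ _ from (Set.mem_ofPred_eq ▸ hω).le) hp0.le
    change (ρ / B) ^ p ≤ ∑ n ∈ Finset.range N, w n * |ξ n ω| ^ p
    rw [Real.div_rpow hρ.le hB0.le, div_le_iff₀' (Real.rpow_pos_of_pos hB0 _)]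
    exact h2.trans h1
  -- The full sum may reach `r` only in the limit, but some partial sum exceeds any `ρ < r`; the
  -- bound is uniform in `N`, and `ρ` is sent to `r` at the end.
  have hlt : ∀ ρ, 0 < ρ → ρ < r → P.real {ω | r ≤ ∑' n, a n * |ξ n ω|} ≤
      K * Real.exp (-d * (ρ / B) ^ p) := by
    intro ρ hρ hρr
    have hK : 0 ≤ K * Real.exp (-d * (ρ / B) ^ p) := by positivity
    refine ENNReal.toReal_le_of_le_ofReal hK ?_
    let s : ℕ → Set Ω := fun N => {ω | ρ < ∑ n ∈ Finset.range N, a n * |ξ n ω|}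
    have hmono : Monotone s := fun N N' h ω hω => lt_of_lt_of_le (show ρ < _ from hω)
      (Finset.sum_le_sum_of_subset_of_nonneg (Finset.range_mono h) fun n _ _ =>
        mul_nonneg (ha n).le (abs_nonneg _))
    calc P {ω | r ≤ ∑' n, a n * |ξ n ω|} ≤ P (⋃ N, s N) := by
          refine measure_mono_ae ?_
          filter_upwards [hconv] with ω hω hr'
          obtain ⟨N, h⟩ := (hω.hasSum.tendsto_sum_nat.eventually_const_lt
            (lt_of_lt_of_le hρr hr')).exists
          exact Set.mem_iUnion.2 ⟨N, h⟩
      _ = ⨆ N, P (s N) := hmono.measure_iUnion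
      _ ≤ _ := iSup_le fun N =>
          (ENNReal.le_ofReal_iff_toReal_le (measure_ne_top _ _) hK).2 (hfin N ρ hρ)
  have hcont : Tendsto (fun ρ => K * Real.exp (-d * (ρ / B) ^ p)) (𝓝[<] r)
      (𝓝 (K * Real.exp (-d * (r / B) ^ p))) := by
    have : Continuous fun ρ : ℝ => K * Real.exp (-d * (ρ / B) ^ p) := by
      have := Real.continuous_rpow_const hp0.le
      fun_prop
    exact this.continuousAt.tendsto.mono_left nhdsWithin_le_nhds
  refine ge_of_tendsto hcont ?_
  filter_upwards [Ioo_mem_nhdsLT hr] with ρ hρ using hlt ρ hρ.1 hρ.2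

/-- Independence evaluates the probability that `|ξ n| ≥ r * t n` for all `n ∈ s`, an event on which
the terms in `s` alone sum to at least `r`. -/
lemma eventually_exp_le_measureReal_tsum_ge {Ω : Type*} [MeasurableSpace Ω] {P : Measure Ω}
    [IsProbabilityMeasure P] {ξ : ℕ → Ω → ℝ} (hindep : iIndepFun ξ P)
    (hident : ∀ n, IdentDistrib (ξ n) (ξ 0) P P) {p c : ℝ} (hc : 0 < c)
    (htail : Tendsto (fun u : ℝ => u ^ (-p) * Real.log (P.real {ω | u ≤ |ξ 0 ω|}))
      atTop (𝓝 (-c)))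
    {a : ℕ → ℝ} (ha : ∀ n, 0 < a n) (hconv : ∀ᵐ ω ∂P, Summable fun n => a n * |ξ n ω|)
    {s : Finset ℕ} {t : ℕ → ℝ} (ht : ∀ n ∈ s, 0 < t n) (hst : ∑ n ∈ s, a n * t n = 1)
    {e : ℝ} (he : c < e) :
    ∀ᶠ r in atTop, Real.exp (-e * (∑ n ∈ s, t n ^ p) * r ^ p) ≤
      P.real {ω | r ≤ ∑' n, a n * |ξ n ω|} := by
  have hev : ∀ᶠ r in atTop, ∀ n ∈ s, Real.exp (-e * (r * t n) ^ p) ≤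
      P.real {ω | r * t n ≤ |ξ 0 ω|} := by
    rw [Filter.eventually_all_finset]
    intro n hn
    exact (tendsto_id.atTop_mul_const (ht n hn)).eventually
      (eventually_exp_le_of_tendsto_log (fun _ => measureReal_nonneg) hc htail he)
  filter_upwards [hev, eventually_gt_atTop 0] with r hr hr0
  have hmeasI : ∀ n, MeasurableSet {x : ℝ | r * t n ≤ |x|} := fun n =>
    measurableSet_le measurable_const measurable_id.abs
  have hprod : P.real (⋂ n ∈ s, {ω | r * t n ≤ |ξ n ω|}) =
      ∏ n ∈ s, P.real {ω | r * t n ≤ |ξ 0 ω|} := by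
    simp only [measureReal_def]
    have hb : P (⋂ n ∈ s, {ω | r * t n ≤ |ξ n ω|}) = ∏ n ∈ s, P {ω | r * t n ≤ |ξ n ω|} :=
      hindep.meas_biInter fun n _ => ⟨_, hmeasI n, rfl⟩
    rw [hb, ENNReal.toReal_prod]
    refine Finset.prod_congr rfl fun n _ => ?_
    congr 1
    exact (hident n).measure_mem_eq (hmeasI n)
  calc Real.exp (-e * (∑ n ∈ s, t n ^ p) * r ^ p)
      = ∏ n ∈ s, Real.exp (-e * (r * t n) ^ p) := by
        rw [← Real.exp_sum, Finset.mul_sum, Finset.sum_mul]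
        congr 1
        refine Finset.sum_congr rfl fun n hn => ?_
        rw [Real.mul_rpow hr0.le (ht n hn).le]; ring
    _ ≤ ∏ n ∈ s, P.real {ω | r * t n ≤ |ξ 0 ω|} :=
        Finset.prod_le_prod (fun n _ => (Real.exp_pos _).le) hr
    _ = P.real (⋂ n ∈ s, {ω | r * t n ≤ |ξ n ω|}) := hprod.symm
    _ ≤ _ := by
        refine ENNReal.toReal_mono (measure_ne_top _ _) (measure_mono_ae ?_)
        filter_upwards [hconv] with ω hω hmem
        have hmem' : ∀ n ∈ s, r * t n ≤ |ξ n ω| := by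
          simpa using (show ω ∈ ⋂ n ∈ s, {ω | r * t n ≤ |ξ n ω|} from hmem)
        change r ≤ ∑' n, a n * |ξ n ω|
        calc r = r * ∑ n ∈ s, a n * t n := by rw [hst, mul_one]
          _ = ∑ n ∈ s, a n * (r * t n) := by
              rw [Finset.mul_sum]
              exact Finset.sum_congr rfl fun n _ => mul_left_comm _ _ _
          _ ≤ ∑ n ∈ s, a n * |ξ n ω| := Finset.sum_le_sum fun n hn =>
              mul_le_mul_of_nonneg_left (hmem' n hn) (ha n).le
          _ ≤ _ := hω.sum_le_tsum _ fun n _ => mul_nonneg (ha n).le (abs_nonneg _)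

/-! ### Logarithmic asymptotics and the ratio limits -/

/-- Logarithmic asymptotics of the upper tail of `∑ a n * |ξ n|`. -/
theorem tendsto_rpow_mul_logUpperTail {Ω : Type*} [MeasurableSpace Ω] {P : Measure Ω}
    [IsProbabilityMeasure P] {ξ : ℕ → Ω → ℝ} (hmeas : ∀ n, Measurable (ξ n))
    (hindep : iIndepFun ξ P) (hident : ∀ n, IdentDistrib (ξ n) (ξ 0) P P)
    {p c : ℝ} (hp : 1 ≤ p) (hc : 0 < c)
    (htail : Tendsto (fun u : ℝ => u ^ (-p) * Real.log (P.real {ω | u ≤ |ξ 0 ω|}))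
      atTop (𝓝 (-c)))
    {q : ℝ≥0∞} (hq : (ENNReal.ofReal p)⁻¹ + q⁻¹ = 1) {a : ℕ → ℝ} (ha : ∀ n, 0 < a n)
    (hconv : ∀ᵐ ω ∂P, Summable fun n => a n * |ξ n ω|) :
    0 < lqNorm q a ∧
      Tendsto (fun r => r ^ (-p) * logUpperTail P ξ a r) atTop (𝓝 (-c * lqNorm q a ^ (-p))) := by
  have hp0 : 0 < p := by linarith
  have hs : Summable a := by
    obtain ⟨u, hu, hu0⟩ := ((eventually_exp_le_of_tendsto_log (fun _ => measureReal_nonneg) hc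
      htail (lt_add_one c)).and (eventually_gt_atTop 0)).exists
    refine summable_of_ae_summable_mul hmeas ha hconv hu0
      (half_pos (Real.exp_pos (-(c + 1) * u ^ p))) fun n => ?_
    rw [mul_div_cancel₀ _ two_ne_zero]
    refine hu.trans (le_of_eq ?_)
    exact congrArg ENNReal.toReal ((hident n).measure_mem_eq
      (s := {x : ℝ | u ≤ |x|}) (measurableSet_le measurable_const measurable_id.abs)).symm
  have hq1 : 1 ≤ q := ENNReal.inv_le_one.1 (hq ▸ le_add_self)
  have hN := lqNorm_pos hq1 ha hs
  refine ⟨hN, ?_⟩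
  have hNp := Real.rpow_pos_of_pos hN (-p)
  -- Positivity of the tail is recorded too: the upper bound needs it for monotonicity of
  -- `Real.log`.
  have hlow : ∀ x < -c * lqNorm q a ^ (-p), ∀ᶠ r in atTop,
      x < r ^ (-p) * logUpperTail P ξ a r ∧ 0 < P.real {ω | r ≤ ∑' n, a n * |ξ n ω|} := by
    intro x hx
    obtain ⟨s, t, ht, hst, hv⟩ := exists_finite_dual_vector hp hq ha hs hN
      (v := -x / c) (by rw [lt_div_iff₀ hc]; linarith)
    have hx0 : 0 < -x := by nlinarith
    set T := ∑ n ∈ s, t n ^ p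
    have hT0 : 0 < T := Finset.sum_pos (fun n hn => Real.rpow_pos_of_pos (ht n hn) _)
      (Finset.nonempty_of_sum_ne_zero (hst ▸ one_ne_zero))
    have hcT : c < -x / T := by
      rw [lt_div_iff₀ hc] at hv
      rw [lt_div_iff₀ hT0]; linarith
    obtain ⟨e, hce, heT⟩ := exists_between hcT
    rw [lt_div_iff₀ hT0] at heT
    filter_upwards [eventually_exp_le_measureReal_tsum_ge hindep hident hc htail ha hconv ht hst
      hce, eventually_gt_atTop 0] with r hr hr0
    have hpos := (Real.exp_pos _).trans_le hr
    refine ⟨?_, hpos⟩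
    have hrp := Real.rpow_pos_of_pos hr0 p
    rw [← Real.le_log_iff_exp_le hpos] at hr
    rw [Real.rpow_neg hr0.le, inv_mul_eq_div, lt_div_iff₀ hrp]
    refine lt_of_lt_of_le ?_ hr
    exact mul_lt_mul_of_pos_right (by linarith) hrp
  refine tendsto_order.2 ⟨fun x hx => (hlow x hx).mono fun r h => h.1, fun x hx => ?_⟩
  have hex : ∃ d B, 0 < d ∧ d < c ∧ lqNorm q a < B ∧ -d * B ^ (-p) < x := by
    have h1 : ∀ᶠ d in 𝓝[<] c, -d * lqNorm q a ^ (-p) < x := by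
      have : Tendsto (fun d => -d * lqNorm q a ^ (-p)) (𝓝[<] c) (𝓝 (-c * lqNorm q a ^ (-p))) :=
        ((continuous_neg.mul continuous_const).tendsto c).mono_left nhdsWithin_le_nhds
      exact this.eventually_lt_const hx
    obtain ⟨d, hd, hd0, hdc⟩ := (h1.and (Ioo_mem_nhdsLT hc)).exists
    have h2 : ∀ᶠ B in 𝓝[>] (lqNorm q a), -d * B ^ (-p) < x := by
      have : Tendsto (fun B : ℝ => -d * B ^ (-p)) (𝓝[>] (lqNorm q a))
          (𝓝 (-d * lqNorm q a ^ (-p))) :=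
        ((Real.continuousAt_rpow_const _ _ (Or.inl hN.ne')).tendsto.const_mul (-d)).mono_left
          nhdsWithin_le_nhds
      exact this.eventually_lt_const hd
    obtain ⟨B, hB, hB'⟩ := (h2.and self_mem_nhdsWithin).exists
    exact ⟨d, B, hd0, hdc, hB', hB⟩
  obtain ⟨d, B, hd0, hdc, hB, hdB⟩ := hex
  have hB0 : 0 < B := hN.trans hB
  obtain ⟨K, hK, hup⟩ :=
    measureReal_tsum_ge_le hmeas hindep hident hp htail hq ha hs hN hconv hB hd0 hdc
  have hlim : Tendsto (fun r : ℝ => r ^ (-p) * Real.log K + -d * B ^ (-p)) atTop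
      (𝓝 (-d * B ^ (-p))) := by
    simpa using ((tendsto_rpow_neg_atTop hp0).mul_const (Real.log K)).add_const (-d * B ^ (-p))
  filter_upwards [hlow (-c * lqNorm q a ^ (-p) - 1) (by linarith), hlim.eventually_lt_const hdB,
    eventually_gt_atTop 0] with r hr hrx hr0
  refine lt_of_le_of_lt ?_ hrx
  have hrp := Real.rpow_pos_of_pos hr0 p
  have hlog : logUpperTail P ξ a r ≤ Real.log K + -d * (r / B) ^ p := by
    refine (Real.log_le_log hr.2 (hup r hr0)).trans (le_of_eq ?_)
    rw [Real.log_mul hK.ne' (Real.exp_pos _).ne', Real.log_exp]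
  refine (mul_le_mul_of_nonneg_left hlog (Real.rpow_nonneg hr0.le (-p))).trans (le_of_eq ?_)
  rw [Real.div_rpow hr0.le hB0.le, Real.rpow_neg hr0.le, Real.rpow_neg hB0.le]
  field_simp

theorem corollary3p2 {Ω : Type*} [MeasurableSpace Ω] (P : Measure Ω) [IsProbabilityMeasure P]
    (ξ : ℕ → Ω → ℝ) (hmeas : ∀ n, Measurable (ξ n))
    (hindep : iIndepFun ξ P) (hident : ∀ n, IdentDistrib (ξ n) (ξ 0) P P)
    (hint : Integrable (ξ 0) P)
    (p c : ℝ) (hp : 1 ≤ p) (hc : 0 < c)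
    (htail : Tendsto (fun u : ℝ => u ^ (-p) * Real.log (P.real {ω | u ≤ |ξ 0 ω|}))
      atTop (𝓝 (-c)))
    (q : ℝ≥0∞) (hq : (ENNReal.ofReal p)⁻¹ + q⁻¹ = 1)
    (a b : ℕ → ℝ) (ha : ∀ n, 0 < a n) (hb : ∀ n, 0 < b n)
    (hasum : Summable fun n => a n ^ (min 2 q).toReal)
    (hbsum : Summable fun n => b n ^ (min 2 q).toReal)
    (haconv : ∀ᵐ ω ∂P, Summable fun n => a n * |ξ n ω|)
    (hbconv : ∀ᵐ ω ∂P, Summable fun n => b n * |ξ n ω|) :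
    Tendsto (fun r : ℝ => logUpperTail P ξ a r / logUpperTail P ξ b r) atTop
        (𝓝 ((lqNorm q b / lqNorm q a) ^ p)) ∧
      Tendsto (fun r : ℝ =>
          logUpperTail P ξ a (r * lqNorm q a) / logUpperTail P ξ b (r * lqNorm q b)) atTop
        (𝓝 1) := by
  obtain ⟨hA, hTa⟩ :=
    tendsto_rpow_mul_logUpperTail hmeas hindep hident hp hc htail hq ha haconv
  obtain ⟨hB, hTb⟩ :=
    tendsto_rpow_mul_logUpperTail hmeas hindep hident hp hc htail hq hb hbconv
  have hBp := Real.rpow_pos_of_pos hB (-p)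
  constructor
  · have h := hTa.div hTb (mul_ne_zero (neg_ne_zero.2 hc.ne') hBp.ne')
    have hlim : -c * lqNorm q a ^ (-p) / (-c * lqNorm q b ^ (-p)) =
        (lqNorm q b / lqNorm q a) ^ p := by
      rw [Real.div_rpow hB.le hA.le, Real.rpow_neg hA.le, Real.rpow_neg hB.le]
      have := (Real.rpow_pos_of_pos hA p).ne'
      have := (Real.rpow_pos_of_pos hB p).ne'
      field_simp
    rw [hlim] at h
    refine h.congr' ?_
    filter_upwards [eventually_gt_atTop 0] with r hr
    exact mul_div_mul_left _ _ (Real.rpow_pos_of_pos hr _).ne'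
  -- Replacing `r` by `r * ‖x‖_q` cancels the norm, leaving the limit `-c` for both sequences.
  · have hscale : ∀ x : ℕ → ℝ, 0 < lqNorm q x →
        Tendsto (fun r => r ^ (-p) * logUpperTail P ξ x r) atTop
          (𝓝 (-c * lqNorm q x ^ (-p))) →
        Tendsto (fun r => r ^ (-p) * logUpperTail P ξ x (r * lqNorm q x)) atTop (𝓝 (-c)) := by
      intro x hx hT
      have hxp := Real.rpow_pos_of_pos hx (-p)
      have h := (hT.comp (tendsto_id.atTop_mul_const hx)).div_const (lqNorm q x ^ (-p))
      rw [mul_div_cancel_right₀ _ hxp.ne'] at h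
      refine h.congr' ?_
      filter_upwards [eventually_gt_atTop 0] with r hr
      simp only [Function.comp_apply, id]
      rw [Real.mul_rpow hr.le hx.le]
      field_simp
    have h := (hscale a hA hTa).div (hscale b hB hTb) (neg_ne_zero.2 hc.ne')
    rw [div_self (neg_ne_zero.2 hc.ne')] at h
    refine h.congr' ?_
    filter_upwards [eventually_gt_atTop 0] with r hr
    exact mul_div_mul_left _ _ (Real.rpow_pos_of_pos hr _).ne'
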